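/- Let $X$ and $U$ be (real or complex) Hilbert spaces, and let $A$, with domain $D(A)$, be the generator of an analytic $C_0$-semigroup $S(t)$ ($t\ge 0$) on $X$ (if $X$ is real, analyticity refers to the complexification of $X$). Let $\gamma\in(0,\tfrac12)$ and let $\rho_0\in\mathbb{R}$ satisfy $\rho_0>\inf_{t>0}\frac1t\ln\|S(t)\|_{\mathcal{L}(X)}$. Let $X_{-\gamma}$ be the dual space, with respect to the pivot space $X$, of $D((\rho_0I-A^*)^\gamma)$ equipped with the norm $\|x\|:=\|(\rho_0I-A^*)^\gamma x\|_X$, and let $B\in\mathcal{L}(U;X_{-\gamma})$, with adjoint $B^*:D((\rho_0I-A^*)^\gamma)\to U$. (Recall that $D(A^*)\subset D((\rho_0I-A^*)^\gamma)$.) Let $\{P_k\}_{k\ge1}$ be a family of orthogonal projections on $X$ such that: 1. $P_kS(t)=S(t)P_k$ for all $k\ge1$ and $t\ge0$; 2. for each $k\ge1$ there are $M_k>0$ and $\alpha_k>0$, with $\alpha_k\to+\infty$ as $k\to+\infty$, such that $$\|(I-P_k)S(t)^*\varphi\|_X\le M_ke^{-\alpha_kt}\|\varphi\|_X\quad\text{for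 all } t\ge0,\ \varphi\in X;$$ 3. there is $T_0>0$ such that for each $k\ge1$ there is $C(k,T_0)>0$ with $$\|P_kS(T_0)^*\varphi\|_X^2\le C(k,T_0)\int_0^{T_0}\|B^*P_kS(t)^*\varphi\|_U^2\,dt\quad\text{for all }\varphi\in D(A^*).$$ Then there is $T_1\ge0$ such that for every $\alpha>0$ there is a constant $C(\alpha)>0$, independent of $T$, such that for every $T>T_1$ there is a constant $D(\alpha,T)>0$ with $$\|S(T)^*\varphi\|_X\le D(\alpha,T)\,\|B^*S(T-\cdot)^*\varphi\|_{L^2(0,T;U)}+C(\alpha)e^{-\alpha T}\|\varphi\|_X\quad\text{for all }\varphi\in D(A^*).$$ -/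

import Mathlib

open Set Filter Topology MeasureTheory

noncomputable section

namespace ControlSystem

universe u v

section Semigroups

variable {𝕜 : Type v} [RCLike 𝕜] {X : Type u} [NormedAddCommGroup X] [InnerProductSpace 𝕜 X]

/-- `S(t)`, `t ≥ 0`, is a `C₀`-semigroup on `X`. (The values of `S` at negative times play no
role.) -/
structure IsC0Semigroup (S : ℝ → X →L[𝕜] X) : Prop where
  zero : S 0 = ContinuousLinearMap.id 𝕜 X
  add : ∀ s t : ℝ, 0 ≤ s → 0 ≤ t → S (s + t) = (S s).comp (S t)
  tendsto_zero : ∀ x : X, Tendsto (fun t : ℝ => S t x) (𝓝[>] 0) (𝓝 x)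

/-- `A` is the infinitesimal generator of `S`: `x ∈ D(A)` and `A x = y` if and only if
`(S(t) x - x) / t → y` as `t → 0⁺`. -/
def IsGenerator (A : X →ₗ.[𝕜] X) (S : ℝ → X →L[𝕜] X) : Prop :=
  ∀ x y : X, (x, y) ∈ A.graph ↔
    Tendsto (fun t : ℝ => (((t⁻¹ : ℝ)) : 𝕜) • (S t x - x)) (𝓝[>] 0) (𝓝 y)

/-- The growth bound `inf_{t > 0} (1/t) ln ‖S(t)‖`, an extended real number (`ln 0 = -∞`). -/
def growthBound (S : ℝ → X →L[𝕜] X) : EReal :=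
  ⨅ t : {t : ℝ // 0 < t}, (((t : ℝ)⁻¹ : ℝ) : EReal) * ENNReal.log ‖S t‖ₑ

/-- The open sector `{z ≠ 0 : |arg z| < θ}`. -/
def sector (θ : ℝ) : Set ℂ := {z | z ≠ 0 ∧ |z.arg| < θ}

/-- The embedding of the scalar field `𝕜` (`ℝ` or `ℂ`) in `ℂ`. -/
def toComplex (c : 𝕜) : ℂ := ⟨RCLike.re c, RCLike.im c⟩

/-- `ι : X → H` exhibits the complex inner product space `H` as the complexification of the inner
product space `X` over `𝕜`. For `𝕜 = ℝ` this says `H = ι X ⊕ i ι X` with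
`‖ι x + i ι y‖² = ‖x‖² + ‖y‖²`; for `𝕜 = ℂ` it says that `ι` is a unitary isomorphism, so that one
may take `H = X`. -/
structure IsComplexification (𝕜 : Type v) [RCLike 𝕜] {X : Type u} [NormedAddCommGroup X]
    [InnerProductSpace 𝕜 X] {H : Type u} [NormedAddCommGroup H] [InnerProductSpace ℂ H]
    (ι : X → H) : Prop where
  map_add : ∀ x y : X, ι (x + y) = ι x + ι y
  map_smul : ∀ (c : 𝕜) (x : X), ι (c • x) = toComplex c • ι x
  inner_map : ∀ x y : X, inner ℂ (ι x) (ι y) = toComplex (inner 𝕜 x y)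
  span_range : Submodule.span ℂ (range ι) = ⊤

/-- `T`, a family of bounded operators on the complex space `H`, is an analytic semigroup in the
sector of half-angle `θ`. -/
structure IsAnalyticInSector {H : Type u} [NormedAddCommGroup H] [InnerProductSpace ℂ H]
    (θ : ℝ) (T : ℂ → H →L[ℂ] H) : Prop where
  differentiableOn : DifferentiableOn ℂ T (sector θ)
  zero : T 0 = ContinuousLinearMap.id ℂ H
  add : ∀ z ∈ sector θ, ∀ w ∈ sector θ, T (z + w) = (T z).comp (T w)
  tendsto_zero : ∀ x : H, Tendsto (fun z => T z x) (𝓝[sector θ] 0) (𝓝 x)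

/-- The semigroup `S` is analytic: (on the complexification of `X`, which is `X` itself if
`𝕜 = ℂ`) it extends to an analytic semigroup in a sector around the positive half-axis. -/
def IsAnalyticSemigroup (S : ℝ → X →L[𝕜] X) : Prop :=
  ∃ (H : Type u) (_ : NormedAddCommGroup H) (_ : InnerProductSpace ℂ H) (ι : X → H),
    IsComplexification 𝕜 ι ∧
    ∃ (θ : ℝ) (T : ℂ → H →L[ℂ] H), 0 < θ ∧ θ ≤ Real.pi / 2 ∧ IsAnalyticInSector θ T ∧
      ∀ t : ℝ, 0 ≤ t → ∀ x : X, T t (ι x) = ι (S t x)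

end Semigroups

section FractionalPowers

variable {𝕜 : Type v} [RCLike 𝕜] {X : Type u} [NormedAddCommGroup X] [InnerProductSpace 𝕜 X]
  [CompleteSpace X]

/-- The bounded operator
`(ρ₀ I - A*)^{-γ} = Γ(γ)⁻¹ ∫₀^∞ t^{γ-1} e^{-ρ₀ t} S(t)* dt`, where `A` generates `S`.
The integral converges in operator norm if `S` is an analytic semigroup, `γ > 0` and `ρ₀` is larger
than the growth bound of `S`. -/
def negFracPower (S : ℝ → X →L[𝕜] X) (ρ₀ γ : ℝ) : X →L[𝕜] X :=
  letI : NormedSpace ℝ (X →L[𝕜] X) := NormedSpace.restrictScalars ℝ 𝕜 (X →L[𝕜] X)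
  (Real.Gamma γ)⁻¹ •
    ∫ t in Ioi (0 : ℝ), (t ^ (γ - 1) * Real.exp (-ρ₀ * t)) • ContinuousLinearMap.adjoint (S t)

/-- The operator `(ρ₀ I - A*)^γ`, the inverse of the injective operator `(ρ₀ I - A*)^{-γ}`; its
domain is the range of the latter. -/
def fracPower (S : ℝ → X →L[𝕜] X) (ρ₀ γ : ℝ) : X →ₗ.[𝕜] X :=
  ((negFracPower S ρ₀ γ : X →ₗ[𝕜] X).toPMap ⊤).inverse

/-- The space `D((ρ₀ I - A*)^γ)`. -/
def FracDomain (S : ℝ → X →L[𝕜] X) (ρ₀ γ : ℝ) : Type u := (fracPower S ρ₀ γ).domain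

instance (S : ℝ → X →L[𝕜] X) (ρ₀ γ : ℝ) : AddCommGroup (FracDomain S ρ₀ γ) :=
  inferInstanceAs (AddCommGroup (fracPower S ρ₀ γ).domain)

instance (S : ℝ → X →L[𝕜] X) (ρ₀ γ : ℝ) : Module 𝕜 (FracDomain S ρ₀ γ) :=
  inferInstanceAs (Module 𝕜 (fracPower S ρ₀ γ).domain)

/-- `(ρ₀ I - A*)^γ` as a linear map on its domain. -/
def fracPowerMap (S : ℝ → X →L[𝕜] X) (ρ₀ γ : ℝ) : FracDomain S ρ₀ γ →ₗ[𝕜] X :=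
  (fracPower S ρ₀ γ).toFun

/-- `D((ρ₀ I - A*)^γ)` carries the norm `‖x‖ = ‖(ρ₀ I - A*)^γ x‖`. -/
instance (S : ℝ → X →L[𝕜] X) (ρ₀ γ : ℝ) : SeminormedAddCommGroup (FracDomain S ρ₀ γ) :=
  SeminormedAddCommGroup.induced _ _ (fracPowerMap S ρ₀ γ)

instance (S : ℝ → X →L[𝕜] X) (ρ₀ γ : ℝ) : NormedSpace 𝕜 (FracDomain S ρ₀ γ) :=
  NormedSpace.induced 𝕜 _ _ (fracPowerMap S ρ₀ γ)

/-- The space `X_{-γ}`, the dual of `D((ρ₀ I - A*)^γ)` with respect to the pivot space `X`: the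
bounded conjugate-linear functionals on `D((ρ₀ I - A*)^γ)`. An element `x` of `X` is identified with
the functional `φ ↦ ⟪φ, x⟫` (the inner product being conjugate-linear in its first argument). -/
abbrev ExtrapolationSpace (S : ℝ → X →L[𝕜] X) (ρ₀ γ : ℝ) : Type (max u v) :=
  FracDomain S ρ₀ γ →L⋆[𝕜] 𝕜

variable {U : Type*} [NormedAddCommGroup U] [InnerProductSpace 𝕜 U] [CompleteSpace U]

/-- The adjoint `B* : D((ρ₀ I - A*)^γ) → U` of `B ∈ L(U; X_{-γ})`: `B* φ` is the element of `U` with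
`⟪B* φ, u⟫_U = (B u)(φ)` for all `u`. -/
def adjointOn {S : ℝ → X →L[𝕜] X} {ρ₀ γ : ℝ} (B : U →L[𝕜] ExtrapolationSpace S ρ₀ γ)
    (φ : FracDomain S ρ₀ γ) : U :=
  (InnerProductSpace.toDual 𝕜 U).symm (B.flip φ)

open scoped Classical in
/-- `B* x` for `x ∈ D((ρ₀ I - A*)^γ)`, which contains `D(A*)`. (The value `0` at the other points of
`X` is a convention.) -/
def controlAdjoint {S : ℝ → X →L[𝕜] X} {ρ₀ γ : ℝ} (B : U →L[𝕜] ExtrapolationSpace S ρ₀ γ)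
    (x : X) : U :=
  if h : x ∈ (fracPower S ρ₀ γ).domain then adjointOn B ⟨x, h⟩ else 0

end FractionalPowers

end ControlSystem

end

/-!
The estimate concerns the semigroup `V t = S(t)*`. Analyticity makes `V` differentiable in norm on
`(0, ∞)`, so that `V δ` takes its values in `D(A*)` for every `δ > 0`. Since
`(ρ₀ - A*)^{-γ} (ρ₀ - A*)^{-(1 - γ)} = (ρ₀ - A*)⁻¹`, the range of `V δ` lies in
`D((ρ₀ - A*)^γ)`, and `K = B* V(δ)` is a bounded operator although `B*` is not.

Given the rate `α`, choose `k` with `α_k ≥ α` and apply the observability of the `k`-th projection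
on `[0, T₀]` to the initial value `V(T - T₀) φ`. Because `P_k` commutes with `V`, the observed
quantity is `B* P_k V(s) φ = B* V(s) φ - K (I - P_k) V(s - δ) φ` with `s ≥ T - T₀ ≥ δ`. The first
term is controlled by the `L²` norm of `B* V φ`; the second, like the unobserved part
`(I - P_k) V(T) φ` of the state, is of size `e^{-α T}`.
-/

noncomputable section

namespace ControlSystem

section NegativePowers

variable {E : Type*} [NormedRing E]

/-- A norm continuous semigroup `V(t)`, `t > 0`, in a Banach algebra whose exponential type is
less than `ρ`. For such `V`, with generator `G`, the powers `(ρ - G)^{-γ}`, `γ > 0`, are given by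
norm convergent integrals. No behaviour is prescribed as `t → 0`. -/
structure IsNormContinuousSemigroup (V : ℝ → E) (ρ : ℝ) : Prop where
  map_add : ∀ s t, 0 < s → 0 < t → V (s + t) = V s * V t
  continuousOn : ContinuousOn V (Ioi 0)
  exists_norm_le : ∃ M ω, ω < ρ ∧ ∀ t, 0 < t → ‖V t‖ ≤ M * Real.exp (ω * t)

theorem IsNormContinuousSemigroup.commute_of_pos {V : ℝ → E} {ρ s t : ℝ}
    (hV : IsNormContinuousSemigroup V ρ) (hs : 0 < s) (ht : 0 < t) : Commute (V s) (V t) := by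
  rw [Commute, SemiconjBy, ← hV.map_add s t hs ht, ← hV.map_add t s ht hs, add_comm]

variable [NormedAlgebra ℝ E]

/-- The power `(ρ - G)^{-γ} = Γ(γ)⁻¹ ∫₀^∞ t^{γ-1} e^{-ρ t} V(t) dt` of the generator `G` of `V`. -/
def negPower (V : ℝ → E) (ρ γ : ℝ) : E :=
  (Real.Gamma γ)⁻¹ • ∫ t in Ioi (0 : ℝ), (t ^ (γ - 1) * Real.exp (-ρ * t)) • V t

theorem integral_rpow_mul_sub_rpow {α β x : ℝ} (hα : 0 < α) (hβ : 0 < β) (hx : 0 < x) :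
    ∫ t in (0 : ℝ)..x, t ^ (α - 1) * (x - t) ^ (β - 1)
      = x ^ (α + β - 1) * ProbabilityTheory.beta α β := by
  have hbeta : (ProbabilityTheory.beta α β : ℂ) = Complex.betaIntegral α β := by
    rw [Complex.betaIntegral_eq_Gamma_mul_div α β (by simpa) (by simpa), ProbabilityTheory.beta]
    push_cast [← Complex.Gamma_ofReal]
    rfl
  apply Complex.ofReal_injective
  rw [← intervalIntegral.integral_ofReal, Complex.ofReal_mul, hbeta,
    Complex.ofReal_cpow hx.le]
  push_cast
  rw [← Complex.betaIntegral_scaled α β hx]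
  refine intervalIntegral.integral_congr fun t ht => ?_
  rw [uIcc_of_le hx.le] at ht
  simp only [Complex.ofReal_cpow ht.1, Complex.ofReal_cpow (sub_nonneg.2 ht.2)]
  push_cast
  rfl

theorem commute_deriv {V : ℝ → E} {t : ℝ} {W : E} (hV : DifferentiableAt ℝ V t)
    (hW : ∀ᶠ s in 𝓝 t, Commute W (V s)) : Commute W (deriv V t) :=
  (hV.hasDerivAt.const_mul W).unique
    ((hV.hasDerivAt.mul_const W).congr_of_eventuallyEq (hW.mono fun _ hs => hs.eq))

namespace IsNormContinuousSemigroup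

variable {V : ℝ → E} {ρ α β γ t δ : ℝ}

theorem integrableOn (hV : IsNormContinuousSemigroup V ρ) (hγ : 0 < γ) :
    IntegrableOn (fun t : ℝ => (t ^ (γ - 1) * Real.exp (-ρ * t)) • V t) (Ioi 0) := by
  obtain ⟨M, ω, hω, hM⟩ := hV.exists_norm_le
  have hdom : IntegrableOn (fun t : ℝ => M * (t ^ (γ - 1) * Real.exp (-(ρ - ω) * t ^ (1 : ℝ))))
      (Ioi 0) :=
    (integrableOn_rpow_mul_exp_neg_mul_rpow (by linarith) one_pos (sub_pos.2 hω)).const_mul M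
  have hweight : ContinuousOn (fun t : ℝ => t ^ (γ - 1) * Real.exp (-ρ * t)) (Ioi 0) :=
    (continuousOn_id.rpow_const fun t ht => Or.inl (ne_of_gt ht)).mul (by fun_prop)
  refine hdom.mono' ((hweight.smul hV.continuousOn).aestronglyMeasurable measurableSet_Ioi) ?_
  filter_upwards [self_mem_ae_restrict measurableSet_Ioi] with t (ht : 0 < t)
  have hpos : 0 ≤ t ^ (γ - 1) * Real.exp (-ρ * t) := by positivity
  calc ‖(t ^ (γ - 1) * Real.exp (-ρ * t)) • V t‖
      ≤ t ^ (γ - 1) * Real.exp (-ρ * t) * (M * Real.exp (ω * t)) := by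
        rw [norm_smul, Real.norm_of_nonneg hpos]
        gcongr
        exact hM t ht
    _ = M * (t ^ (γ - 1) * (Real.exp (-ρ * t) * Real.exp (ω * t))) := by ring
    _ = M * (t ^ (γ - 1) * Real.exp (-(ρ - ω) * t ^ (1 : ℝ))) := by
        rw [← Real.exp_add, Real.rpow_one]
        ring_nf

theorem hasDerivAt_add (hV : IsNormContinuousSemigroup V ρ) (hδ : DifferentiableAt ℝ V δ)
    (hδ₀ : 0 < δ) (ht : 0 < t) : HasDerivAt V (V t * deriv V δ) (t + δ) := by
  have hshift : HasDerivAt (fun s => V (s - t)) (deriv V δ) (t + δ) := by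
    refine HasDerivAt.comp_sub_const (t + δ) t ?_
    rw [add_sub_cancel_left]
    exact hδ.hasDerivAt
  refine (hshift.const_mul (V t)).congr_of_eventuallyEq ?_
  filter_upwards [lt_mem_nhds (lt_add_of_pos_right t hδ₀)] with s hs
  rw [← hV.map_add t (s - t) ht (sub_pos.2 hs), add_sub_cancel]

theorem tendsto_exp_smul_atTop (hV : IsNormContinuousSemigroup V ρ) :
    Tendsto (fun t => Real.exp (-ρ * t) • V t) atTop (𝓝 0) := by
  obtain ⟨M, ω, hω, hM⟩ := hV.exists_norm_le
  have hlim : Tendsto (fun t => M * Real.exp (-((ρ - ω) * t))) atTop (𝓝 0) := by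
    simpa using (Real.tendsto_exp_neg_atTop_nhds_zero.comp
      (tendsto_id.const_mul_atTop (sub_pos.2 hω))).const_mul M
  refine squeeze_zero_norm' ?_ hlim
  filter_upwards [eventually_gt_atTop 0] with t ht
  calc ‖Real.exp (-ρ * t) • V t‖
      ≤ Real.exp (-ρ * t) * (M * Real.exp (ω * t)) := by
        rw [norm_smul, Real.norm_of_nonneg (Real.exp_pos _).le]
        gcongr
        exact hM t ht
    _ = M * Real.exp (-((ρ - ω) * t)) := by
        rw [mul_left_comm, ← Real.exp_add]
        ring_nf

theorem commute_negPower (hV : IsNormContinuousSemigroup V ρ) (hγ : 0 < γ) {W : E}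
    (hW : ∀ t, 0 < t → Commute W (V t)) : Commute W (negPower V ρ γ) := by
  refine Commute.smul_right ?_ _
  rw [Commute, SemiconjBy, ← integral_const_mul_of_integrable (hV.integrableOn hγ),
    ← integral_mul_const_of_integrable (hV.integrableOn hγ)]
  refine setIntegral_congr_fun measurableSet_Ioi fun t ht => ?_
  simp only [mul_smul_comm, smul_mul_assoc, (hW t ht).eq]

variable [CompleteSpace E]

theorem negPower_mul_negPower (hV : IsNormContinuousSemigroup V ρ) (hα : 0 < α) (hβ : 0 < β) :
    negPower V ρ α * negPower V ρ β = negPower V ρ (α + β) := by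
  have hconv := integral_posConvolution (hV.integrableOn hα) (hV.integrableOn hβ)
    (ContinuousLinearMap.mul ℝ E)
  have hinner : ∀ x ∈ Ioi (0 : ℝ), (∫ t in (0 : ℝ)..x,
        ((t ^ (α - 1) * Real.exp (-ρ * t)) • V t)
          * (((x - t) ^ (β - 1) * Real.exp (-ρ * (x - t))) • V (x - t)))
      = ProbabilityTheory.beta α β • (x ^ (α + β - 1) * Real.exp (-ρ * x)) • V x := by
    intro x (hx : 0 < x)
    rw [smul_smul, ← mul_assoc, mul_comm (ProbabilityTheory.beta α β),
      ← integral_rpow_mul_sub_rpow hα hβ hx, ← intervalIntegral.integral_mul_const,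
      ← intervalIntegral.integral_smul_const]
    simp only [intervalIntegral.integral_of_le hx.le, integral_Ioc_eq_integral_Ioo]
    refine setIntegral_congr_fun measurableSet_Ioo fun t ht => ?_
    have hVx : V x = V t * V (x - t) := by
      rw [← hV.map_add t (x - t) ht.1 (sub_pos.2 ht.2), add_sub_cancel]
    have hexp : Real.exp (-ρ * x) = Real.exp (-ρ * t) * Real.exp (-ρ * (x - t)) := by
      rw [← Real.exp_add]
      ring_nf
    simp only [hVx, hexp, smul_mul_smul_comm]
    congr 1
    ring
  simp only [ContinuousLinearMap.mul_apply'] at hconv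
  rw [negPower, negPower, smul_mul_smul_comm, ← hconv,
    setIntegral_congr_fun measurableSet_Ioi hinner, integral_smul, smul_smul, negPower,
    ProbabilityTheory.beta]
  congr 1
  have := (Real.Gamma_pos_of_pos hα).ne'
  have := (Real.Gamma_pos_of_pos hβ).ne'
  field_simp

theorem negPower_one_mul (hV : IsNormContinuousSemigroup V ρ) (hδ : DifferentiableAt ℝ V δ)
    (hδ₀ : 0 < δ) : negPower V ρ 1 * (ρ • V δ - deriv V δ) = V δ := by
  have hint := hV.integrableOn one_pos
  have hder : ∀ t ∈ Ioi (0 : ℝ), HasDerivAt (fun t => Real.exp (-ρ * t) • V (t + δ))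
      (-((t ^ ((1 : ℝ) - 1) * Real.exp (-ρ * t)) • V t * (ρ • V δ - deriv V δ))) t := by
    intro t (ht : 0 < t)
    have hexp : HasDerivAt (fun t => Real.exp (-ρ * t)) (Real.exp (-ρ * t) * -ρ) t := by
      simpa using ((hasDerivAt_id t).const_mul (-ρ)).exp
    refine (hexp.smul ((hV.hasDerivAt_add hδ hδ₀ ht).comp_add_const t δ)).congr_deriv ?_
    rw [hV.map_add t δ ht hδ₀]
    simp only [sub_self, Real.rpow_zero, one_mul, smul_mul_assoc, mul_sub, mul_smul_comm,
      smul_smul, mul_neg, neg_smul, mul_comm ρ]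
    abel
  have hcont : ContinuousWithinAt (fun t => Real.exp (-ρ * t) • V (t + δ)) (Ici 0) 0 := by
    refine (ContinuousAt.smul (by fun_prop) ?_).continuousWithinAt
    exact ContinuousAt.comp (by simpa using hδ.continuousAt) (by fun_prop)
  have hlim : Tendsto (fun t => Real.exp (-ρ * t) • V (t + δ)) atTop (𝓝 0) := by
    rw [← zero_mul (V δ)]
    refine (hV.tendsto_exp_smul_atTop.mul_const (V δ)).congr' ?_
    filter_upwards [eventually_gt_atTop 0] with t ht
    rw [hV.map_add t δ ht hδ₀, smul_mul_assoc]
  have hftc := integral_Ioi_of_hasDerivAt_of_tendsto hcont hder (hint.mul_const _).neg hlim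
  rw [integral_neg, integral_mul_const_of_integrable hint] at hftc
  simpa [negPower] using hftc

theorem exists_negPower_mul_eq_negPower_one (hV : IsNormContinuousSemigroup V ρ)
    (hγ : γ ∈ Ioc (0 : ℝ) 1) :
    ∃ Q, negPower V ρ γ * Q = negPower V ρ 1 ∧ Q * negPower V ρ γ = negPower V ρ 1 := by
  obtain ⟨hγ₀, hγ₁⟩ := hγ
  obtain rfl | hγ₁ := hγ₁.eq_or_lt
  · exact ⟨1, mul_one _, one_mul _⟩
  · have hγ' : 0 < 1 - γ := sub_pos.2 hγ₁
    refine ⟨negPower V ρ (1 - γ), ?_, ?_⟩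
    · rw [hV.negPower_mul_negPower hγ₀ hγ', add_sub_cancel]
    · rw [hV.negPower_mul_negPower hγ' hγ₀, sub_add_cancel]

theorem exists_negPower_mul_eq (hV : IsNormContinuousSemigroup V ρ) (hγ : γ ∈ Ioc (0 : ℝ) 1)
    (hδ : DifferentiableAt ℝ V δ) (hδ₀ : 0 < δ) :
    ∃ R, negPower V ρ γ * R = V δ ∧ R * negPower V ρ γ = V δ := by
  obtain ⟨Q, hNQ, hQN⟩ := hV.exists_negPower_mul_eq_negPower_one hγ
  have hcommute : ∀ s, 0 < s → Commute (negPower V ρ γ) (V s) := fun s hs =>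
    (hV.commute_negPower hγ.1 fun t ht => hV.commute_of_pos hs ht).symm
  have hG : Commute (negPower V ρ γ) (ρ • V δ - deriv V δ) :=
    ((hcommute δ hδ₀).smul_right ρ).sub_right
      (commute_deriv hδ ((lt_mem_nhds hδ₀).mono hcommute))
  refine ⟨Q * (ρ • V δ - deriv V δ), ?_, ?_⟩
  · rw [← mul_assoc, hNQ, hV.negPower_one_mul hδ hδ₀]
  · rw [mul_assoc, ← hG.eq, ← mul_assoc, hQN, hV.negPower_one_mul hδ hδ₀]

end IsNormContinuousSemigroup

end NegativePowers

section GrowthBound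

variable {𝕜 : Type*} [RCLike 𝕜] {X : Type*} [NormedAddCommGroup X] [InnerProductSpace 𝕜 X]
  {S : ℝ → X →L[𝕜] X}

namespace IsC0Semigroup

theorem tendsto_nhdsGE_zero (hS : IsC0Semigroup S) (x : X) :
    Tendsto (fun t : ℝ => S t x) (𝓝[≥] 0) (𝓝 x) := by
  have hright : ContinuousWithinAt (fun t : ℝ => S t x) (Ioi 0) 0 := by
    simpa [ContinuousWithinAt, hS.zero] using hS.tendsto_zero x
  simpa [ContinuousWithinAt, hS.zero] using continuousWithinAt_Ioi_iff_Ici.1 hright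

theorem exists_pos_norm_le_of_mem_Icc [CompleteSpace X] (hS : IsC0Semigroup S) :
    ∃ δ : ℝ, 0 < δ ∧ ∃ K : ℝ, ∀ t ∈ Icc 0 δ, ‖S t‖ ≤ K := by
  by_contra! hcon
  choose t ht htn using fun n : ℕ =>
    hcon (1 / ((n : ℝ) + 1)) (by positivity) n
  have htend : Tendsto t atTop (𝓝[≥] 0) :=
    tendsto_nhdsWithin_iff.2 ⟨squeeze_zero (fun n => (ht n).1) (fun n => (ht n).2)
      tendsto_one_div_add_atTop_nhds_zero_nat, Eventually.of_forall fun n => (ht n).1⟩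
  obtain ⟨C, hC⟩ := banach_steinhaus (g := fun n : ℕ => S (t n)) fun x =>
    (((hS.tendsto_nhdsGE_zero x).comp htend).norm.bddAbove_range).imp fun _ hC n => hC ⟨n, rfl⟩
  obtain ⟨n, hn⟩ := exists_nat_gt C
  exact (hn.trans (htn n)).not_ge (hC n)

theorem norm_nat_mul_add_le (hS : IsC0Semigroup S) {δ r : ℝ} (hδ : 0 ≤ δ) (hr : 0 ≤ r) (n : ℕ) :
    ‖S (n * δ + r)‖ ≤ ‖S δ‖ ^ n * ‖S r‖ := by
  induction n with
  | zero => simp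
  | succ n ih =>
    have hstep : S ((n + 1 : ℕ) * δ + r) = S δ * S (n * δ + r) := by
      rw [Nat.cast_add_one, add_one_mul, add_comm ((n : ℝ) * δ), add_assoc]
      exact hS.add δ _ hδ (by positivity)
    calc ‖S ((n + 1 : ℕ) * δ + r)‖ ≤ ‖S δ‖ * ‖S (n * δ + r)‖ := hstep ▸ norm_mul_le _ _
      _ ≤ ‖S δ‖ * (‖S δ‖ ^ n * ‖S r‖) := by gcongr
      _ = ‖S δ‖ ^ (n + 1) * ‖S r‖ := by ring

theorem exists_norm_le_mul_exp (hS : IsC0Semigroup S) {δ K ω : ℝ} (hδ : 0 < δ)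
    (hK : ∀ t ∈ Icc 0 δ, ‖S t‖ ≤ K) (hω : ‖S δ‖ ≤ Real.exp (ω * δ)) :
    ∃ M, ∀ t, 0 ≤ t → ‖S t‖ ≤ M * Real.exp (ω * t) := by
  refine ⟨Real.exp (|ω| * δ) * K, fun t ht => ?_⟩
  have hn : ⌊t / δ⌋₊ * δ ≤ t := (le_div_iff₀ hδ).1 (Nat.floor_le (by positivity))
  have ht' : t < (⌊t / δ⌋₊ + 1) * δ := (div_lt_iff₀ hδ).1 (Nat.lt_floor_add_one _)
  obtain ⟨r, hr⟩ : ∃ r, ⌊t / δ⌋₊ * δ + r = t := ⟨_, add_sub_cancel _ _⟩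
  have hr₀ : 0 ≤ r := by linarith
  have hrδ : r ≤ δ := by linarith
  calc ‖S t‖ ≤ ‖S δ‖ ^ ⌊t / δ⌋₊ * ‖S r‖ := by
        simpa only [hr] using hS.norm_nat_mul_add_le hδ.le hr₀ ⌊t / δ⌋₊
    _ ≤ Real.exp (ω * δ) ^ ⌊t / δ⌋₊ * K := by
        gcongr
        exact hK r ⟨hr₀, hrδ⟩
    _ = Real.exp (-ω * r + ω * t) * K := by
        rw [← Real.exp_nat_mul]
        congr 2
        linear_combination ω * hr
    _ ≤ Real.exp (|ω| * δ + ω * t) * K := by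
        have hK₀ : 0 ≤ K := (norm_nonneg _).trans (hK r ⟨hr₀, hrδ⟩)
        gcongr
        exact neg_le_abs ω
    _ = Real.exp (|ω| * δ) * K * Real.exp (ω * t) := by rw [Real.exp_add]; ring

theorem exists_norm_le_of_mem_Icc [CompleteSpace X] (hS : IsC0Semigroup S) (b : ℝ) :
    ∃ K : ℝ, ∀ t ∈ Icc 0 b, ‖S t‖ ≤ K := by
  obtain ⟨δ, hδ, K, hK⟩ := hS.exists_pos_norm_le_of_mem_Icc
  have hω : ‖S δ‖ ≤ Real.exp (‖S δ‖ / δ * δ) := by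
    rw [div_mul_cancel₀ _ hδ.ne']
    linarith [Real.add_one_le_exp ‖S δ‖]
  obtain ⟨M, hM⟩ := hS.exists_norm_le_mul_exp hδ hK hω
  have hM₀ : 0 ≤ M := by simpa using (norm_nonneg _).trans (hM 0 le_rfl)
  refine ⟨M * Real.exp (‖S δ‖ / δ * b), fun t ht => (hM t ht.1).trans ?_⟩
  gcongr
  exact ht.2

end IsC0Semigroup

theorem exists_norm_le_exp_of_growthBound_lt {ρ : ℝ} (hρ : growthBound S < (ρ : EReal)) :
    ∃ t₀ ω : ℝ, 0 < t₀ ∧ ω < ρ ∧ ‖S t₀‖ ≤ Real.exp (ω * t₀) := by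
  obtain ⟨⟨t, ht⟩, h⟩ := iInf_lt_iff.1 hρ
  obtain hSt | hSt := eq_or_ne (S t) 0
  · exact ⟨t, ρ - 1, ht, sub_one_lt ρ, by rw [hSt, norm_zero]; positivity⟩
  have hpos : 0 < ‖S t‖ := norm_pos_iff.2 hSt
  have hlog : ENNReal.log ‖S t‖ₑ = ((Real.log ‖S t‖ : ℝ) : EReal) := by
    rw [ENNReal.log_pos_real' (by simpa using hpos), toReal_enorm]
  simp only [hlog] at h
  rw [← EReal.coe_mul, EReal.coe_lt_coe_iff] at h
  refine ⟨t, t⁻¹ * Real.log ‖S t‖, ht, h, ?_⟩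
  rw [mul_right_comm, inv_mul_cancel₀ ht.ne', one_mul, Real.exp_log hpos]

theorem IsC0Semigroup.exists_lt_norm_le_mul_exp [CompleteSpace X] (hS : IsC0Semigroup S) {ρ : ℝ}
    (hρ : growthBound S < (ρ : EReal)) :
    ∃ M ω : ℝ, ω < ρ ∧ ∀ t, 0 ≤ t → ‖S t‖ ≤ M * Real.exp (ω * t) := by
  obtain ⟨t₀, ω, ht₀, hω, hbound⟩ := exists_norm_le_exp_of_growthBound_lt hρ
  obtain ⟨K, hK⟩ := hS.exists_norm_le_of_mem_Icc t₀
  obtain ⟨M, hM⟩ := hS.exists_norm_le_mul_exp ht₀ hK hbound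
  exact ⟨M, ω, hω, hM⟩

end GrowthBound

open scoped InnerProduct

theorem differentiableAt_of_norm_slope_sub_le {𝕂 E F : Type*} [NontriviallyNormedField 𝕂]
    [NormedAddCommGroup E] [NormedSpace 𝕂 E] [CompleteSpace E]
    [NormedAddCommGroup F] [NormedSpace 𝕂 F] {f : 𝕂 → E} {g : 𝕂 → F} {t : 𝕂}
    (hg : DifferentiableAt 𝕂 g t)
    (hfg : ∀ᶠ p in 𝓝[≠] t ×ˢ 𝓝[≠] t,
      ‖slope f t p.1 - slope f t p.2‖ ≤ ‖slope g t p.1 - slope g t p.2‖) :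
    DifferentiableAt 𝕂 f t := by
  have hcauchy_g := (cauchy_map_iff.1 (hasDerivAt_iff_tendsto_slope.1 hg.hasDerivAt).cauchy_map).2
  rw [tendsto_uniformity_iff_dist_tendsto_zero] at hcauchy_g
  have hcauchy_f : Cauchy (map (slope f t) (𝓝[≠] t)) := by
    refine cauchy_map_iff.2 ⟨inferInstance, ?_⟩
    rw [tendsto_uniformity_iff_dist_tendsto_zero]
    refine squeeze_zero' (Eventually.of_forall fun _ => dist_nonneg) ?_ hcauchy_g
    simpa only [dist_eq_norm] using hfg
  obtain ⟨f', hf'⟩ := CompleteSpace.complete hcauchy_f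
  exact (hasDerivAt_iff_tendsto_slope.2 hf').differentiableAt

section RealOperatorAlgebra

variable {𝕜 : Type*} [RCLike 𝕜] {X : Type*} [NormedAddCommGroup X] [InnerProductSpace 𝕜 X]

/-- The bounded operators on a space over `𝕜` as a real normed algebra, the structure with respect
to which operator-valued functions of time are differentiated and integrated. -/
abbrev operatorRealAlgebra : NormedAlgebra ℝ (X →L[𝕜] X) :=
  NormedAlgebra.restrictScalars ℝ 𝕜 (X →L[𝕜] X)

attribute [local instance] operatorRealAlgebra

theorem operatorRealStarModule [CompleteSpace X] : StarModule ℝ (X →L[𝕜] X) where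
  star_smul r L := by
    change star ((r : 𝕜) • L) = (r : 𝕜) • star L
    rw [star_smul, RCLike.star_def, RCLike.conj_ofReal]

/-- `S` is differentiable at positive times in the operator norm. -/
def IsNormDifferentiable (S : ℝ → X →L[𝕜] X) : Prop :=
  ∀ t, 0 < t → DifferentiableAt ℝ S t

attribute [local instance] operatorRealStarModule

theorem IsNormDifferentiable.hasDerivAt_adjoint [CompleteSpace X] {S : ℝ → X →L[𝕜] X} {t : ℝ}
    (hS : IsNormDifferentiable S) (ht : 0 < t) :
    HasDerivAt (fun s => (S s)†) ((deriv S t)†) t :=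
  (hS t ht).hasDerivAt.star

theorem IsNormDifferentiable.continuousOn_adjoint [CompleteSpace X] {S : ℝ → X →L[𝕜] X}
    (hS : IsNormDifferentiable S) : ContinuousOn (fun t => (S t)†) (Ioi 0) :=
  fun _ ht => (hS.hasDerivAt_adjoint ht).continuousAt.continuousWithinAt

end RealOperatorAlgebra

section Analytic

universe u

variable {𝕜 : Type*} [RCLike 𝕜] {X : Type u} [NormedAddCommGroup X] [InnerProductSpace 𝕜 X]
  {H : Type u} [NormedAddCommGroup H] [InnerProductSpace ℂ H]

attribute [local instance] operatorRealAlgebra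

theorem toComplex_ofReal (r : ℝ) : toComplex (r : 𝕜) = (r : ℂ) := by
  apply Complex.ext <;> simp [toComplex]

namespace IsComplexification

variable {ι : X → H}

theorem norm_map (hι : IsComplexification 𝕜 ι) (x : X) : ‖ι x‖ = ‖x‖ := by
  rw [← sq_eq_sq₀ (norm_nonneg _) (norm_nonneg _), ← inner_self_eq_norm_sq (𝕜 := ℂ),
    ← inner_self_eq_norm_sq (𝕜 := 𝕜), hι.inner_map]
  rfl

theorem map_sub (hι : IsComplexification 𝕜 ι) (x y : X) : ι (x - y) = ι x - ι y := by
  rw [eq_sub_iff_add_eq, ← hι.map_add, sub_add_cancel]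

theorem norm_le_norm (hι : IsComplexification 𝕜 ι) {L : X →L[𝕜] X} {Λ : H →L[ℂ] H}
    (hΛ : ∀ x, Λ (ι x) = ι (L x)) : ‖L‖ ≤ ‖Λ‖ := by
  refine L.opNorm_le_bound (norm_nonneg _) fun x => ?_
  rw [← hι.norm_map, ← hι.norm_map x, ← hΛ]
  exact Λ.le_opNorm (ι x)

theorem slope_apply (hι : IsComplexification 𝕜 ι) {S : ℝ → X →L[𝕜] X} {T : ℝ → H →L[ℂ] H}
    {s t : ℝ} (hs : ∀ x, T s (ι x) = ι (S s x)) (ht : ∀ x, T t (ι x) = ι (S t x)) (x : X) :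
    slope T t s (ι x) = ι (slope S t s x) := by
  change ((s - t)⁻¹ : ℝ) • (T s (ι x) - T t (ι x)) = ι ((((s - t)⁻¹ : ℝ) : 𝕜) • (S s x - S t x))
  rw [hι.map_smul, toComplex_ofReal, hι.map_sub, hs, ht, Complex.coe_smul]

end IsComplexification

theorem IsAnalyticInSector.differentiableAt {θ : ℝ} {T : ℂ → H →L[ℂ] H}
    (hT : IsAnalyticInSector θ T) (hθ : 0 < θ) {t : ℝ} (ht : 0 < t) :
    DifferentiableAt ℝ (fun s : ℝ => T s) t := by
  have hsector : MapsTo (fun s : ℝ => (s : ℂ)) (Ioi 0) (sector θ) := fun s (hs : 0 < s) =>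
    ⟨Complex.ofReal_ne_zero.2 hs.ne', by rwa [Complex.arg_ofReal_of_nonneg hs.le, abs_zero]⟩
  have hT' : DifferentiableWithinAt ℝ T (sector θ) (t : ℂ) :=
    (hT.differentiableOn _ (hsector ht)).restrictScalars ℝ
  exact (hT'.comp t Complex.ofRealCLM.differentiableAt.differentiableWithinAt
    hsector).differentiableAt (Ioi_mem_nhds ht)

theorem IsAnalyticSemigroup.isNormDifferentiable [CompleteSpace X] {S : ℝ → X →L[𝕜] X}
    (hS : IsAnalyticSemigroup S) : IsNormDifferentiable S := by
  intro t ht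
  obtain ⟨H, _, _, ι, hι, θ, T, hθ, -, hT, hTS⟩ := hS
  refine differentiableAt_of_norm_slope_sub_le (hT.differentiableAt hθ ht) ?_
  have hpos : ∀ᶠ s in 𝓝[≠] t, 0 < s := (lt_mem_nhds ht).filter_mono nhdsWithin_le_nhds
  filter_upwards [hpos.prod_mk hpos] with p hp
  refine hι.norm_le_norm fun x => ?_
  rw [sub_apply, sub_apply, hι.map_sub,
    hι.slope_apply (T := fun s : ℝ => T s) (hTS _ hp.1.le) (hTS _ ht.le),
    hι.slope_apply (T := fun s : ℝ => T s) (hTS _ hp.2.le) (hTS _ ht.le)]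

end Analytic

section Generator

variable {𝕜 : Type*} [RCLike 𝕜] {X : Type*} [NormedAddCommGroup X] [InnerProductSpace 𝕜 X]
  {A : X →ₗ.[𝕜] X} {S : ℝ → X →L[𝕜] X} {t : ℝ}

attribute [local instance] operatorRealAlgebra

theorem IsNormDifferentiable.tendsto_smul_sub_apply (hS' : IsNormDifferentiable S) (ht : 0 < t)
    (x : X) : Tendsto (fun r : ℝ => ((r⁻¹ : ℝ) : 𝕜) • (S (t + r) x - S t x)) (𝓝[>] 0)
      (𝓝 (deriv S t x)) :=
  ((ContinuousLinearMap.apply 𝕜 X x).continuous.tendsto _).comp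
    (hS' t ht).hasDerivAt.tendsto_slope_zero_right

namespace IsGenerator

theorem mem_graph (hA : IsGenerator A S) (hS : IsC0Semigroup S) (hS' : IsNormDifferentiable S)
    (ht : 0 < t) (x : X) : (S t x, deriv S t x) ∈ A.graph := by
  refine (hA _ _).2 ((hS'.tendsto_smul_sub_apply ht x).congr' ?_)
  filter_upwards [self_mem_nhdsWithin] with r (hr : 0 < r)
  rw [add_comm t r, hS.add r t hr.le ht.le, ContinuousLinearMap.comp_apply]

theorem apply_eq_deriv_apply (hA : IsGenerator A S) (hS : IsC0Semigroup S)
    (hS' : IsNormDifferentiable S) (ht : 0 < t) (x : A.domain) : S t (A x) = deriv S t x := by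
  refine tendsto_nhds_unique ((((S t).continuous.tendsto _).comp
    ((hA x (A x)).1 (A.mem_graph x))).congr' ?_) (hS'.tendsto_smul_sub_apply ht x)
  filter_upwards [self_mem_nhdsWithin] with r (hr : 0 < r)
  simp only [Function.comp_apply, hS.add t r ht.le hr.le, map_smul, _root_.map_sub,
    ContinuousLinearMap.comp_apply]

theorem dense_domain (hA : IsGenerator A S) (hS : IsC0Semigroup S)
    (hS' : IsNormDifferentiable S) : Dense (A.domain : Set X) := fun x => by
  refine mem_closure_of_tendsto (hS.tendsto_zero x) ?_
  filter_upwards [self_mem_nhdsWithin] with t ht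
  exact LinearPMap.mem_domain_of_mem_graph (hA.mem_graph hS hS' ht x)

variable [CompleteSpace X]

theorem adjoint_deriv_apply (hA : IsGenerator A S) (hS : IsC0Semigroup S)
    (hS' : IsNormDifferentiable S) (ht : 0 < t) (φ : A.adjoint.domain) :
    ((deriv S t)†) φ = ((S t)†) (A.adjoint φ) := by
  refine ext_inner_right 𝕜 fun x => ?_
  obtain ⟨z, hz, hAz⟩ := (LinearPMap.mem_graph_iff A).1 (hA.mem_graph hS hS' ht x)
  have hadjoint := LinearPMap.adjoint_isFormalAdjoint (hA.dense_domain hS hS') φ z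
  rw [ContinuousLinearMap.adjoint_inner_left, ContinuousLinearMap.adjoint_inner_left]
  simp only at hz hAz
  rw [← hz, hadjoint, hAz]

theorem adjoint_apply_mem_domain (hA : IsGenerator A S) (hS : IsC0Semigroup S)
    (hS' : IsNormDifferentiable S) (ht : 0 < t) (φ : X) : ((S t)†) φ ∈ A.adjoint.domain := by
  refine LinearPMap.mem_adjoint_domain_of_exists _ ⟨((deriv S t)†) φ, fun x => ?_⟩
  rw [ContinuousLinearMap.adjoint_inner_left, ContinuousLinearMap.adjoint_inner_left,
    hA.apply_eq_deriv_apply hS hS' ht x]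

end IsGenerator

end Generator

section AdjointSemigroup

variable {𝕜 : Type*} [RCLike 𝕜] {X : Type*} [NormedAddCommGroup X] [InnerProductSpace 𝕜 X]
  [CompleteSpace X] {A : X →ₗ.[𝕜] X} {S : ℝ → X →L[𝕜] X} {ρ γ δ : ℝ}

attribute [local instance] operatorRealAlgebra

theorem IsC0Semigroup.adjoint_add (hS : IsC0Semigroup S) {s t : ℝ} (hs : 0 ≤ s) (ht : 0 ≤ t) :
    (S (s + t))† = (S s)† * (S t)† := by
  rw [add_comm, hS.add t s ht hs, ContinuousLinearMap.adjoint_comp]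
  rfl

theorem IsC0Semigroup.eq_zero_of_adjoint_apply_eq_zero (hS : IsC0Semigroup S) {y : X}
    (hy : ∀ t, 0 < t → ((S t)†) y = 0) : y = 0 := by
  have hself : Tendsto (fun t : ℝ => inner 𝕜 y (S t y)) (𝓝[>] 0) (𝓝 (inner 𝕜 y y)) :=
    tendsto_const_nhds.inner (hS.tendsto_zero y)
  refine inner_self_eq_zero.1 (tendsto_nhds_unique hself (tendsto_const_nhds.congr' ?_))
  filter_upwards [self_mem_nhdsWithin] with t ht
  rw [← ContinuousLinearMap.adjoint_inner_left, hy t ht, inner_zero_left]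

theorem IsC0Semigroup.isNormContinuousSemigroup_adjoint (hS : IsC0Semigroup S)
    (hS' : IsNormDifferentiable S) (hρ : growthBound S < (ρ : EReal)) :
    IsNormContinuousSemigroup (fun t => (S t)†) ρ where
  map_add s t hs ht := hS.adjoint_add hs.le ht.le
  continuousOn := hS'.continuousOn_adjoint
  exists_norm_le := by
    obtain ⟨M, ω, hω, hM⟩ := hS.exists_lt_norm_le_mul_exp hρ
    refine ⟨M, ω, hω, fun t ht => ?_⟩
    rw [LinearIsometryEquiv.norm_map]
    exact hM t ht.le

theorem exists_negFracPower_mul_eq_adjoint (hS : IsC0Semigroup S) (hS' : IsNormDifferentiable S)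
    (hρ : growthBound S < (ρ : EReal)) (hγ : γ ∈ Ioc (0 : ℝ) 1) (hδ : 0 < δ) :
    ∃ R, negFracPower S ρ γ * R = (S δ)† ∧ R * negFracPower S ρ γ = (S δ)† :=
  (hS.isNormContinuousSemigroup_adjoint hS' hρ).exists_negPower_mul_eq hγ
    (hS'.hasDerivAt_adjoint hδ).differentiableAt hδ

theorem negFracPower_injective (hS : IsC0Semigroup S) (hS' : IsNormDifferentiable S)
    (hρ : growthBound S < (ρ : EReal)) (hγ : γ ∈ Ioc (0 : ℝ) 1) :
    Function.Injective (negFracPower S ρ γ) := by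
  refine (injective_iff_map_eq_zero _).2 fun y hy => hS.eq_zero_of_adjoint_apply_eq_zero
    fun t ht => ?_
  obtain ⟨R, -, hR⟩ := exists_negFracPower_mul_eq_adjoint hS hS' hρ hγ ht
  rw [← hR, mul_apply_eq_comp, hy, map_zero]

theorem exists_negFracPower_adjoint_eq (hA : IsGenerator A S) (hS : IsC0Semigroup S)
    (hS' : IsNormDifferentiable S) (hρ : growthBound S < (ρ : EReal)) (hγ : γ ∈ Ioc (0 : ℝ) 1)
    {φ : X} (hφ : φ ∈ A.adjoint.domain) :
    ∃ (Q : X →L[𝕜] X) (ψ : X), ∀ t, 0 < t →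
      negFracPower S ρ γ (Q (((S t)†) ψ)) = ((S t)†) φ := by
  have hV := hS.isNormContinuousSemigroup_adjoint hS' hρ
  obtain ⟨Q, hQ, -⟩ := hV.exists_negPower_mul_eq_negPower_one hγ
  refine ⟨Q, (ρ : 𝕜) • φ - A.adjoint ⟨φ, hφ⟩, fun t ht => ?_⟩
  have hderiv := hS'.hasDerivAt_adjoint ht
  have hresolvent := hV.negPower_one_mul hderiv.differentiableAt ht
  rw [hderiv.deriv, ← hQ] at hresolvent
  have hψ : ((S t)†) ((ρ : 𝕜) • φ - A.adjoint ⟨φ, hφ⟩) = (ρ • (S t)† - (deriv S t)†) φ := by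
    rw [map_sub, map_smul, ← hA.adjoint_deriv_apply hS hS' ht]
    rfl
  rw [hψ]
  exact DFunLike.congr_fun hresolvent φ

end AdjointSemigroup

section ControlAdjoint

variable {𝕜 : Type*} [RCLike 𝕜] {X : Type*} [NormedAddCommGroup X] [InnerProductSpace 𝕜 X]
  [CompleteSpace X] {U : Type*} [NormedAddCommGroup U] [InnerProductSpace 𝕜 U] [CompleteSpace U]
  {A : X →ₗ.[𝕜] X} {S : ℝ → X →L[𝕜] X} {ρ γ δ : ℝ}

theorem negFracPower_apply_mem_domain (y : X) :
    negFracPower S ρ γ y ∈ (fracPower S ρ γ).domain := by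
  rw [fracPower, LinearPMap.inverse_domain]
  exact ⟨⟨y, Submodule.mem_top⟩, rfl⟩

/-- The operator `(ρ I - A*)^{-γ}` as a linear isometry of `X` into the normed space
`D((ρ I - A*)^γ)`. -/
def negFracPowerIsometry (hinj : Function.Injective (negFracPower S ρ γ)) :
    X →ₗᵢ[𝕜] FracDomain S ρ γ where
  toLinearMap := LinearMap.codRestrict (fracPower S ρ γ).domain (negFracPower S ρ γ : X →ₗ[𝕜] X)
    negFracPower_apply_mem_domain
  norm_map' y := by
    have hker : ((negFracPower S ρ γ : X →ₗ[𝕜] X).toPMap ⊤).toFun.ker = ⊥ :=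
      LinearMap.ker_eq_bot'.2 fun x hx => Subtype.ext (hinj (hx.trans (map_zero _).symm))
    exact congrArg norm (LinearPMap.inverse_apply_eq hker (x := ⟨y, Submodule.mem_top⟩) rfl)

theorem exists_controlAdjoint_negFracPower (B : U →L[𝕜] ExtrapolationSpace S ρ γ)
    (hinj : Function.Injective (negFracPower S ρ γ)) :
    ∃ L : X →L[𝕜] U, ∀ y, controlAdjoint B (negFracPower S ρ γ y) = L y := by
  let riesz : (U →L[𝕜] 𝕜) →L⋆[𝕜] U :=
    ((InnerProductSpace.toDual 𝕜 U).symm.toContinuousLinearEquiv : (U →L[𝕜] 𝕜) →L⋆[𝕜] U)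
  refine ⟨(riesz.comp B.flip).comp (negFracPowerIsometry hinj).toContinuousLinearMap,
    fun y => ?_⟩
  rw [controlAdjoint, dif_pos (negFracPower_apply_mem_domain y)]
  rfl

theorem exists_controlAdjoint_adjoint_apply (hS : IsC0Semigroup S) (hS' : IsNormDifferentiable S)
    (hρ : growthBound S < (ρ : EReal)) (hγ : γ ∈ Ioc (0 : ℝ) 1)
    (B : U →L[𝕜] ExtrapolationSpace S ρ γ) (hδ : 0 < δ) :
    ∃ K : X →L[𝕜] U, ∀ y, controlAdjoint B (((S δ)†) y) = K y := by
  obtain ⟨L, hL⟩ := exists_controlAdjoint_negFracPower B (negFracPower_injective hS hS' hρ hγ)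
  obtain ⟨R, hR, -⟩ := exists_negFracPower_mul_eq_adjoint hS hS' hρ hγ hδ
  exact ⟨L.comp R, fun y => by rw [← hR, mul_apply_eq_comp, hL, ContinuousLinearMap.comp_apply]⟩

theorem IsGenerator.intervalIntegrable_sq_norm_controlAdjoint (hA : IsGenerator A S)
    (hS : IsC0Semigroup S) (hS' : IsNormDifferentiable S) (hρ : growthBound S < (ρ : EReal))
    (hγ : γ ∈ Ioc (0 : ℝ) 1) (B : U →L[𝕜] ExtrapolationSpace S ρ γ) {φ : X}
    (hφ : φ ∈ A.adjoint.domain) {T : ℝ} (hT : 0 ≤ T) :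
    IntervalIntegrable (fun t => ‖controlAdjoint B (((S t)†) φ)‖ ^ 2) volume 0 T := by
  obtain ⟨L, hL⟩ := exists_controlAdjoint_negFracPower B (negFracPower_injective hS hS' hρ hγ)
  obtain ⟨Q, ψ, hψ⟩ := exists_negFracPower_adjoint_eq hA hS hS' hρ hγ hφ
  obtain ⟨K, hK⟩ := hS.exists_norm_le_of_mem_Icc T
  have hcontinuous : ContinuousOn (fun t => (L.comp Q) (((S t)†) ψ)) (Ioc 0 T) :=
    (L.comp Q).continuous.comp_continuousOn
      ((hS'.continuousOn_adjoint.mono Ioc_subset_Ioi_self).clm_apply continuousOn_const)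
  have hbound : ∀ t ∈ Ioc 0 T, ‖(L.comp Q) (((S t)†) ψ)‖ ≤ ‖L.comp Q‖ * (K * ‖ψ‖) :=
    fun t ht => (L.comp Q).le_of_opNorm_le_of_le le_rfl <|
      ContinuousLinearMap.le_of_opNorm_le _
        ((LinearIsometryEquiv.norm_map _ _).trans_le (hK t (Ioc_subset_Icc_self ht))) ψ
  rw [intervalIntegrable_iff_integrableOn_Ioc_of_le hT]
  refine IntegrableOn.congr_fun (f := fun t => ‖(L.comp Q) (((S t)†) ψ)‖ ^ 2) ?_
    (fun t ht => by simp only [← hψ t ht.1, hL, ContinuousLinearMap.comp_apply]) measurableSet_Ioc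
  refine IntegrableOn.of_bound measure_Ioc_lt_top
    ((hcontinuous.norm.pow 2).aestronglyMeasurable measurableSet_Ioc)
    ((‖L.comp Q‖ * (K * ‖ψ‖)) ^ 2) ?_
  filter_upwards [ae_restrict_mem measurableSet_Ioc] with t ht
  rw [norm_pow, norm_norm]
  exact pow_le_pow_left₀ (norm_nonneg _) (hbound t ht) 2

end ControlAdjoint

theorem integral_sq_le_of_le_add {f g : ℝ → ℝ} {c T₀ τ : ℝ} (hT₀ : 0 ≤ T₀) (hτ : 0 ≤ τ)
    (hf : ∀ t ∈ Icc 0 T₀, 0 ≤ f t) (hfg : ∀ t ∈ Icc 0 T₀, f t ≤ g (t + τ) + c)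
    (hg : IntervalIntegrable (fun t => g t ^ 2) volume 0 (T₀ + τ)) :
    ∫ t in (0 : ℝ)..T₀, f t ^ 2 ≤ 2 * (∫ t in (0 : ℝ)..(T₀ + τ), g t ^ 2) + 2 * T₀ * c ^ 2 := by
  have hgτ : IntervalIntegrable (fun t => g (t + τ) ^ 2) volume 0 T₀ := by
    have hsub : uIcc τ (T₀ + τ) ⊆ uIcc 0 (T₀ + τ) := by
      rw [uIcc_of_le (by linarith), uIcc_of_le (by linarith)]
      exact Icc_subset_Icc_left hτ
    simpa using (hg.mono_set hsub).comp_add_right τ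
  have hbound := (hgτ.const_mul 2).add (intervalIntegrable_const (c := 2 * c ^ 2))
  calc ∫ t in (0 : ℝ)..T₀, f t ^ 2
      ≤ ∫ t in (0 : ℝ)..T₀, (2 * g (t + τ) ^ 2 + 2 * c ^ 2) := by
        rw [intervalIntegral.integral_of_le hT₀, intervalIntegral.integral_of_le hT₀]
        refine integral_mono_of_nonneg (Eventually.of_forall fun t => sq_nonneg _)
          ((intervalIntegrable_iff_integrableOn_Ioc_of_le hT₀).1 hbound) ?_
        filter_upwards [ae_restrict_mem measurableSet_Ioc] with t ht
        have ht' := Ioc_subset_Icc_self ht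
        calc f t ^ 2 ≤ (g (t + τ) + c) ^ 2 := pow_le_pow_left₀ (hf t ht') (hfg t ht') 2
          _ ≤ 2 * (g (t + τ) ^ 2 + c ^ 2) := add_sq_le
          _ = 2 * g (t + τ) ^ 2 + 2 * c ^ 2 := mul_add _ _ _
    _ = 2 * (∫ t in τ..(T₀ + τ), g t ^ 2) + 2 * T₀ * c ^ 2 := by
        rw [intervalIntegral.integral_add (hgτ.const_mul 2) intervalIntegrable_const,
          intervalIntegral.integral_const_mul,
          intervalIntegral.integral_comp_add_right (fun t => g t ^ 2),
          intervalIntegral.integral_const, zero_add, sub_zero, smul_eq_mul]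
        ring
    _ ≤ 2 * (∫ t in (0 : ℝ)..(T₀ + τ), g t ^ 2) + 2 * T₀ * c ^ 2 := by
        gcongr
        exact intervalIntegral.integral_mono_interval hτ (by linarith) le_rfl
          (Eventually.of_forall fun t => sq_nonneg _) hg

section Observability

variable {𝕜 : Type*} [NontriviallyNormedField 𝕜] {X : Type*} [NormedAddCommGroup X]
  [NormedSpace 𝕜 X] {U : Type*} [NormedAddCommGroup U] [NormedSpace 𝕜 U]
  {V : ℝ → X →L[𝕜] X} {P : X →L[𝕜] X} {K : X →L[𝕜] U} {b : X → U}

theorem norm_apply_le_of_commute {W : X →L[𝕜] X} (hPW : Commute P W) (hb : ∀ y, b (W y) = K y)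
    (y : X) : ‖b (P (W y))‖ ≤ ‖b (W y)‖ + ‖K‖ * ‖y - P y‖ := by
  have hPy : P (W y) = W (P y) := DFunLike.congr_fun hPW.eq y
  calc ‖b (P (W y))‖ = ‖K y - K (y - P y)‖ := by rw [hPy, hb, map_sub, sub_sub_cancel]
    _ ≤ ‖K y‖ + ‖K (y - P y)‖ := norm_sub_le _ _
    _ ≤ ‖b (W y)‖ + ‖K‖ * ‖y - P y‖ := by
        rw [hb]
        gcongr
        exact K.le_opNorm _

theorem integral_sq_norm_apply_le {M a δ T₀ T : ℝ}
    (hadd : ∀ s t, 0 ≤ s → 0 ≤ t → V (s + t) = V s * V t) (hPV : Commute P (V δ))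
    (hb : ∀ y, b (V δ y) = K y) (hM : 0 ≤ M) (ha : 0 ≤ a)
    (hdecay : ∀ t, 0 ≤ t → ∀ y, ‖V t y - P (V t y)‖ ≤ M * Real.exp (-a * t) * ‖y‖)
    (hδ : 0 ≤ δ) (hT₀ : 0 ≤ T₀) (hT : T₀ + δ ≤ T) {φ : X}
    (hint : IntervalIntegrable (fun t => ‖b (V t φ)‖ ^ 2) volume 0 T) :
    ∫ t in (0 : ℝ)..T₀, ‖b (P (V t (V (T - T₀) φ)))‖ ^ 2
      ≤ 2 * (∫ t in (0 : ℝ)..T, ‖b (V t φ)‖ ^ 2)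
        + 2 * T₀ * (‖K‖ * (M * Real.exp (-a * (T - (T₀ + δ))) * ‖φ‖)) ^ 2 := by
  have hpointwise : ∀ t ∈ Icc 0 T₀, ‖b (P (V t (V (T - T₀) φ)))‖
      ≤ ‖b (V (t + (T - T₀)) φ)‖ + ‖K‖ * (M * Real.exp (-a * (T - (T₀ + δ))) * ‖φ‖) := by
    intro t ht
    have hs : 0 ≤ t + (T - T₀) - δ := by linarith [ht.1]
    have hsmooth : V (t + (T - T₀)) φ = V δ (V (t + (T - T₀) - δ) φ) := by
      rw [← mul_apply_eq_comp, ← hadd δ _ hδ hs, add_sub_cancel]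
    have hadvance : V t (V (T - T₀) φ) = V (t + (T - T₀)) φ := by
      rw [hadd t _ ht.1 (by linarith), mul_apply_eq_comp]
    rw [hadvance, hsmooth]
    refine (norm_apply_le_of_commute hPV hb _).trans ?_
    gcongr
    refine (hdecay _ hs φ).trans ?_
    gcongr M * Real.exp ?_ * ‖φ‖
    nlinarith [mul_nonneg ha ht.1]
  have hT' : T₀ + (T - T₀) = T := add_sub_cancel _ _
  simpa only [hT'] using integral_sq_le_of_le_add (g := fun t => ‖b (V t φ)‖) hT₀ (by linarith)
    (fun _ _ => norm_nonneg _) hpointwise (hT'.symm ▸ hint)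

theorem norm_le_of_projected_observability {M a C δ T₀ T : ℝ}
    (hadd : ∀ s t, 0 ≤ s → 0 ≤ t → V (s + t) = V s * V t) (hPV : Commute P (V δ))
    (hb : ∀ y, b (V δ y) = K y) (hM : 0 ≤ M) (ha : 0 ≤ a)
    (hdecay : ∀ t, 0 ≤ t → ∀ y, ‖V t y - P (V t y)‖ ≤ M * Real.exp (-a * t) * ‖y‖)
    (hδ : 0 ≤ δ) (hT₀ : 0 ≤ T₀) (hT : T₀ + δ ≤ T) {φ : X}
    (hint : IntervalIntegrable (fun t => ‖b (V t φ)‖ ^ 2) volume 0 T) (hC : 0 ≤ C)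
    (hobs : ‖P (V T₀ (V (T - T₀) φ))‖ ^ 2
      ≤ C * ∫ t in (0 : ℝ)..T₀, ‖b (P (V t (V (T - T₀) φ)))‖ ^ 2) :
    ‖V T φ‖ ≤ √(2 * C) * √(∫ t in (0 : ℝ)..T, ‖b (V t φ)‖ ^ 2)
      + (√(2 * C * T₀) * ‖K‖ * Real.exp (a * (T₀ + δ)) + 1) * M * Real.exp (-a * T) * ‖φ‖ := by
  set I := ∫ t in (0 : ℝ)..T, ‖b (V t φ)‖ ^ 2
  set c := ‖K‖ * (M * Real.exp (-a * (T - (T₀ + δ))) * ‖φ‖) with hc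
  have hT' : 0 ≤ T - T₀ := by linarith
  have hproj : ‖P (V T φ)‖ ≤ √(2 * C) * √I + √(2 * C * T₀) * c := by
    have hsplit : V T φ = V T₀ (V (T - T₀) φ) := by
      rw [← mul_apply_eq_comp, ← hadd T₀ _ hT₀ hT', add_sub_cancel]
    have hI : 0 ≤ I := intervalIntegral.integral_nonneg (by linarith) fun t _ => sq_nonneg _
    have hc₀ : 0 ≤ c := by positivity
    refine le_of_sq_le_sq ?_ (by positivity)
    calc ‖P (V T φ)‖ ^ 2 ≤ C * (2 * I + 2 * T₀ * c ^ 2) := by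
          rw [hsplit]
          refine hobs.trans (mul_le_mul_of_nonneg_left ?_ hC)
          exact integral_sq_norm_apply_le hadd hPV hb hM ha hdecay hδ hT₀ hT hint
      _ = (√(2 * C) * √I) ^ 2 + (√(2 * C * T₀) * c) ^ 2 := by
          rw [mul_pow √(2 * C), mul_pow √(2 * C * T₀), Real.sq_sqrt (by positivity),
            Real.sq_sqrt hI, Real.sq_sqrt (by positivity)]
          ring
      _ ≤ (√(2 * C) * √I + √(2 * C * T₀) * c) ^ 2 :=
          pow_add_pow_le (by positivity) (mul_nonneg (Real.sqrt_nonneg _) hc₀) two_ne_zero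
  have hexp : Real.exp (-a * (T - (T₀ + δ))) = Real.exp (a * (T₀ + δ)) * Real.exp (-a * T) := by
    rw [← Real.exp_add]
    ring_nf
  calc ‖V T φ‖ ≤ ‖P (V T φ)‖ + ‖V T φ - P (V T φ)‖ := norm_le_insert' _ _
    _ ≤ √(2 * C) * √I + √(2 * C * T₀) * c + M * Real.exp (-a * T) * ‖φ‖ :=
        add_le_add hproj (hdecay T (by linarith) φ)
    _ = _ := by
        rw [hc, hexp]
        ring

end Observability

end ControlSystem

end

theorem theorem4p4_general {𝕜 : Type*} [RCLike 𝕜]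
    {X : Type*} [NormedAddCommGroup X] [InnerProductSpace 𝕜 X] [CompleteSpace X]
    {U : Type*} [NormedAddCommGroup U] [InnerProductSpace 𝕜 U] [CompleteSpace U]
    (A : X →ₗ.[𝕜] X) (S : ℝ → X →L[𝕜] X)
    (hS : ControlSystem.IsC0Semigroup S) (hA : ControlSystem.IsGenerator A S)
    (hS' : ControlSystem.IsNormDifferentiable S)
    (γ : ℝ) (hγ : γ ∈ Set.Ioc (0 : ℝ) 1)
    (ρ₀ : ℝ) (hρ₀ : ControlSystem.growthBound S < (ρ₀ : EReal))
    (B : U →L[𝕜] ControlSystem.ExtrapolationSpace S ρ₀ γ)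
    {ι : Type*} (P : ι → X →L[𝕜] X)
    (hcomm : ∀ k, ∀ t : ℝ, 0 ≤ t → Commute (P k) (ContinuousLinearMap.adjoint (S t)))
    (M α : ι → ℝ) (hM : ∀ k, 0 < M k) (hα : ¬BddAbove (Set.range α))
    (hdiss : ∀ k, ∀ t : ℝ, 0 ≤ t → ∀ φ : X,
      ‖ContinuousLinearMap.adjoint (S t) φ - P k (ContinuousLinearMap.adjoint (S t) φ)‖
        ≤ M k * Real.exp (-α k * t) * ‖φ‖)
    (T₀ T₁ : ℝ) (hT₀ : 0 ≤ T₀) (hT₁ : T₀ < T₁)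
    (hobs : ∀ k, ∃ C : ℝ, 0 < C ∧ ∀ φ ∈ A.adjoint.domain,
      ‖P k (ContinuousLinearMap.adjoint (S T₀) φ)‖ ^ 2
        ≤ C * ∫ t in (0 : ℝ)..T₀,
            ‖ControlSystem.controlAdjoint B (P k (ContinuousLinearMap.adjoint (S t) φ))‖ ^ 2)
    (a : ℝ) (ha : 0 ≤ a) :
    ∃ C : ℝ, 0 < C ∧ ∃ D : ℝ, 0 < D ∧ ∀ T : ℝ, T₁ ≤ T → ∀ φ ∈ A.adjoint.domain,
      ‖ContinuousLinearMap.adjoint (S T) φ‖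
        ≤ D * Real.sqrt (∫ t in (0 : ℝ)..T,
              ‖ControlSystem.controlAdjoint B (ContinuousLinearMap.adjoint (S (T - t)) φ)‖ ^ 2)
          + C * Real.exp (-a * T) * ‖φ‖ := by
  obtain ⟨_, ⟨k, rfl⟩, hak⟩ := not_bddAbove_iff.1 hα a
  obtain ⟨C, hC, hobs⟩ := hobs k
  have hδ : 0 < T₁ - T₀ := sub_pos.2 hT₁
  obtain ⟨K, hK⟩ := ControlSystem.exists_controlAdjoint_adjoint_apply hS hS' hρ₀ hγ B hδ
  have hMk := hM k
  have hdecay : ∀ t : ℝ, 0 ≤ t → ∀ φ : X,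
      ‖ContinuousLinearMap.adjoint (S t) φ - P k (ContinuousLinearMap.adjoint (S t) φ)‖
        ≤ M k * Real.exp (-a * t) * ‖φ‖ := fun t ht φ =>
    (hdiss k t ht φ).trans (by gcongr)
  refine ⟨(√(2 * C * T₀) * ‖K‖ * Real.exp (a * (T₀ + (T₁ - T₀))) + 1) * M k, by positivity,
    √(2 * C), by positivity, fun T hT φ hφ => ?_⟩
  rw [intervalIntegral.integral_comp_sub_left
    (fun t => ‖ControlSystem.controlAdjoint B (ContinuousLinearMap.adjoint (S t) φ)‖ ^ 2) T,
    sub_self, sub_zero]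
  exact ControlSystem.norm_le_of_projected_observability
    (V := fun t => ContinuousLinearMap.adjoint (S t)) (fun s t => hS.adjoint_add)
    (hcomm k _ hδ.le) hK hMk.le ha hdecay hδ.le hT₀ (by linarith)
    (hA.intervalIntegrable_sq_norm_controlAdjoint hS hS' hρ₀ hγ B hφ (by linarith)) hC.le
    (hobs _ (hA.adjoint_apply_mem_domain hS hS' (by linarith) φ))

theorem theorem4p4 {𝕜 : Type*} [RCLike 𝕜]
    {X : Type*} [NormedAddCommGroup X] [InnerProductSpace 𝕜 X] [CompleteSpace X]
    {U : Type*} [NormedAddCommGroup U] [InnerProductSpace 𝕜 U] [CompleteSpace U]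
    (A : X →ₗ.[𝕜] X) (S : ℝ → X →L[𝕜] X)
    (hS : ControlSystem.IsC0Semigroup S) (hA : ControlSystem.IsGenerator A S) (hSan : ControlSystem.IsAnalyticSemigroup S)
    (γ : ℝ) (hγ : γ ∈ Set.Ioo (0 : ℝ) (1 / 2))
    (ρ₀ : ℝ) (hρ₀ : ControlSystem.growthBound S < (ρ₀ : EReal))
    (B : U →L[𝕜] ControlSystem.ExtrapolationSpace S ρ₀ γ)
    (P : ℕ+ → X →L[𝕜] X) (hP : ∀ k, IsStarProjection (P k))
    (hcomm : ∀ k, ∀ t : ℝ, 0 ≤ t → (P k).comp (S t) = (S t).comp (P k))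
    (hdiss : ∃ M α : ℕ+ → ℝ, (∀ k, 0 < M k) ∧ (∀ k, 0 < α k) ∧
      Filter.Tendsto α Filter.atTop Filter.atTop ∧
      ∀ k, ∀ t : ℝ, 0 ≤ t → ∀ φ : X,
        ‖ContinuousLinearMap.adjoint (S t) φ - P k (ContinuousLinearMap.adjoint (S t) φ)‖
          ≤ M k * Real.exp (-α k * t) * ‖φ‖)
    (hobs : ∃ T₀ : ℝ, 0 < T₀ ∧ ∀ k, ∃ C : ℝ, 0 < C ∧ ∀ φ ∈ A.adjoint.domain,
      ‖P k (ContinuousLinearMap.adjoint (S T₀) φ)‖ ^ 2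
        ≤ C * ∫ t in (0 : ℝ)..T₀,
            ‖ControlSystem.controlAdjoint B (P k (ContinuousLinearMap.adjoint (S t) φ))‖ ^ 2) :
    ∃ T₀ : ℝ, 0 ≤ T₀ ∧ ∀ α : ℝ, 0 < α → ∃ C : ℝ, 0 < C ∧ ∀ T : ℝ, T₀ < T →
      ∃ D : ℝ, 0 < D ∧ ∀ φ ∈ A.adjoint.domain,
        ‖ContinuousLinearMap.adjoint (S T) φ‖
          ≤ D * Real.sqrt (∫ t in (0 : ℝ)..T,
                ‖ControlSystem.controlAdjoint B (ContinuousLinearMap.adjoint (S (T - t)) φ)‖ ^ 2)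
            + C * Real.exp (-α * T) * ‖φ‖ := by
  obtain ⟨M, α, hM, -, hα, hdiss⟩ := hdiss
  obtain ⟨T₀, hT₀, hobs⟩ := hobs
  have hcomm' : ∀ k, ∀ t : ℝ, 0 ≤ t → Commute (P k) (ContinuousLinearMap.adjoint (S t)) :=
    fun k t ht => (show Commute (star (P k)) (S t) from
      (hP k).isSelfAdjoint.star_eq.symm ▸ hcomm k t ht).star_right
  refine ⟨T₀ + 1, by positivity, fun a ha => ?_⟩
  obtain ⟨C, hC, D, hD, hest⟩ := theorem4p4_general A S hS hA hSan.isNormDifferentiable γ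
    ⟨hγ.1, by linarith [hγ.2]⟩ ρ₀ hρ₀ B P hcomm' M α hM
    (Filter.not_bddAbove_of_tendsto_atTop hα) hdiss T₀ (T₀ + 1) hT₀.le (lt_add_one T₀) hobs a ha.le
  exact ⟨C, hC, fun T hT => ⟨D, hD, hest T hT.le⟩⟩
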